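/- A partition of a nonnegative integer $n$ is a finite nonincreasing sequence of positive integers with sum $n$ (the empty sequence is the partition of $0$). The hook number of a cell of the Young diagram of a partition is the number of cells to its right in the same row, plus the number of cells below it in the same column, plus $1$. A partition is a $3$-core if none of its hook numbers is a multiple of $3$. Let $A_3(n)$ denote the number of ordered pairs $(\lambda_1,\lambda_2)$ of (possibly empty) $3$-core partitions such that the sum of all the parts of $\lambda_1$ and $\lambda_2$ equals $n$. **Theorem.** Let $p$ be a prime and let $k,n$ be nonnegative integers such that $p\nmid 3n+2$. (1) If $p\equiv 1\pmod 3$, then $(2p^k-2)/3$ is an integer and $$A_3\Big(p^k n+\frac{2p^k-2}{3}\Big)=\frac{p^{k+1}-1}{p-1}\,A_3(n).$$ (2) If $p\equiv 2\pmod 3$, then $(2p^{2k}-2)/3$ is an integer and $$A_3\Big(p^{2k} n+\frac{2p^{2k}-2}{3}\Big)=\frac{p^{2k+1}-1}{p-1}\,A_3(n).$$ -/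

import Mathlib

/-- The Young diagram of a partition: its rows, from the top, are the parts in nonincreasing
order. -/
def Nat.Partition.youngDiagram {n : ℕ} (lam : n.Partition) : YoungDiagram :=
  YoungDiagram.ofRowLens (lam.parts.sort (· ≥ ·)) (Multiset.pairwise_sort _ _).sortedGE

/-- The hook number of the cell `c = (i, j)` of a Young diagram: the number of cells to the right
of `c` in its row, plus the number of cells below `c` in its column, plus one for `c` itself.
(For `c ∈ μ` neither subtraction truncates.) -/
def YoungDiagram.hookNumber (μ : YoungDiagram) (c : ℕ × ℕ) : ℕ :=
  (μ.rowLen c.1 - (c.2 + 1)) + (μ.colLen c.2 - (c.1 + 1)) + 1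

/-- A partition is a `t`-core if none of its hook numbers is a multiple of `t`. -/
def Nat.Partition.IsCore (t : ℕ) {n : ℕ} (lam : n.Partition) : Prop :=
  ∀ c ∈ lam.youngDiagram.cells, ¬ t ∣ lam.youngDiagram.hookNumber c

/-- Partition pairs of `n`: ordered pairs of (possibly empty) partitions, of `a` and of `b`
respectively, where `a + b = n`. -/
abbrev PartitionPair (n : ℕ) : Type :=
  Σ s : Finset.HasAntidiagonal.antidiagonal n, Nat.Partition s.1.1 × Nat.Partition s.1.2

/-- `corePairCount t n` is `A_t(n)`, the number of partition pairs of `n` with `t`-cores.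
(`PartitionPair n` is a finite type.) -/
noncomputable def corePairCount (t n : ℕ) : ℕ :=
  Nat.card {P : PartitionPair n // P.2.1.IsCore t ∧ P.2.2.IsCore t}

/-! Everything follows from the closed formula `3 * A_3(n) = σ(3n+2)`. Since `3N + 2 = p^k (3n + 2)`
for the shifted argument `N` (`p^(2k)` in the second case) and `p ∤ 3n + 2`, multiplicativity of `σ`
then gives the factor `1 + p + ... + p^k`.

The formula has two ingredients. First, the number of 3-cores of `n` is `∑ χ(d)` over `d ∣ 3n+1`
(`card_isCore_three`, `ncard_coreParams`). The first column hook lengths of a 3-core are initial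
segments of the classes 1 and 2 mod 3, so 3-cores are pairs `(A, B)` of naturals on a conic. Up to a
sixfold symmetry these are the Eisenstein integers of norm `3n+1`, and `ncard_eisReps` counts them.

Second, for `m ≡ 2 (mod 3)` the convolution square of `∑_{d ∣ n} χ(d)` at `m` is `σ(m)/3`
(`three_mul_sum_chiSum`). This is proved in Liouville's manner, by swaps and a shear on the
solutions of `a x + b y = m`. -/

/-- The nontrivial character modulo `3`. -/
def chiThree (n : ℕ) : ℤ := if n % 3 = 1 then 1 else if n % 3 = 2 then -1 else 0

/-- The divisor sum `∑_{d ∣ n} χ(d)` of the nontrivial character modulo `3`. -/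
def chiSum (n : ℕ) : ℤ := ∑ d ∈ n.divisors, chiThree d

/-! ### Liouville-style evaluation of the convolution -/

theorem chiThree_mul (a b : ℕ) : chiThree (a * b) = chiThree a * chiThree b := by
  unfold chiThree
  have ha : a % 3 < 3 := Nat.mod_lt _ (by norm_num)
  have hb : b % 3 < 3 := Nat.mod_lt _ (by norm_num)
  rw [Nat.mul_mod]
  generalize a % 3 = r at *
  generalize b % 3 = s at *
  interval_cases r <;> interval_cases s <;> simp

/-- The involution `d ↦ m / d` reverses the sign of `χ`, because `χ(d) χ(m / d) = χ(m) = -1`. -/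
theorem chiSum_eq_zero {m : ℕ} (hm : m % 3 = 2) : chiSum m = 0 := by
  have h : chiSum m = - chiSum m := by
    unfold chiSum
    conv_lhs => rw [← Nat.sum_div_divisors]
    rw [← Finset.sum_neg_distrib]
    refine Finset.sum_congr rfl fun d hd => ?_
    have h1 := chiThree_mul d (m / d)
    rw [Nat.mul_div_cancel' (Nat.dvd_of_mem_divisors hd)] at h1
    have h2 : chiThree m = -1 := by simp [chiThree, hm]
    rw [h2] at h1
    unfold chiThree at *
    split_ifs at * <;> simp_all
  linarith

/-- The quadruples `((a, x), (b, y))` of positive integers with `a * x + b * y = m`. -/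
def quadruples (m : ℕ) : Finset ((ℕ × ℕ) × (ℕ × ℕ)) :=
  (Finset.HasAntidiagonal.antidiagonal m).biUnion fun s => s.1.divisorsAntidiagonal ×ˢ s.2.divisorsAntidiagonal

theorem mem_quadruples {m : ℕ} {q : (ℕ × ℕ) × (ℕ × ℕ)} :
    q ∈ quadruples m ↔ q.1.1 * q.1.2 + q.2.1 * q.2.2 = m ∧
      0 < q.1.1 ∧ 0 < q.1.2 ∧ 0 < q.2.1 ∧ 0 < q.2.2 := by
  obtain ⟨⟨a, x⟩, b, y⟩ := q
  simp only [quadruples, Finset.mem_biUnion, Finset.HasAntidiagonal.mem_antidiagonal, Finset.mem_product,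
    Nat.mem_divisorsAntidiagonal, Prod.exists]
  constructor
  · rintro ⟨i, j, rfl, ⟨rfl, h1⟩, rfl, h2⟩
    simp only [ne_eq, mul_eq_zero, not_or] at h1 h2
    exact ⟨rfl, by omega, by omega, by omega, by omega⟩
  · rintro ⟨h, ha, hx, hb, hy⟩
    exact ⟨_, _, h, ⟨rfl, by positivity⟩, rfl, by positivity⟩

theorem sum_chiSum_mul_chiSum (m : ℕ) :
    ∑ s ∈ Finset.HasAntidiagonal.antidiagonal m, chiSum s.1 * chiSum s.2 =
      ∑ q ∈ quadruples m, chiThree q.1.2 * chiThree q.2.2 := by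
  have hE (n : ℕ) : chiSum n = ∑ d ∈ n.divisorsAntidiagonal, chiThree d.2 :=
    (Nat.sum_divisorsAntidiagonal' (f := fun _ d => chiThree d)).symm
  rw [quadruples, Finset.sum_biUnion]
  · refine Finset.sum_congr rfl fun s _ => ?_
    rw [Finset.sum_product, hE, hE, Finset.sum_mul_sum]
  · intro s _ t _ hst
    refine Finset.disjoint_left.2 fun q hs ht => hst ?_
    simp only [Finset.mem_product, Nat.mem_divisorsAntidiagonal] at hs ht
    exact Prod.ext (hs.1.1.symm.trans ht.1.1) (hs.2.1.symm.trans ht.2.1)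

/-- Swapping the two pairs exchanges `x < y` and `y < x`; the case `x = y` would give `3 ∣ x`, hence
`3 ∣ m`. -/
theorem card_quadruples_three_dvd_add {m : ℕ} (hm : m % 3 = 2) :
    ((quadruples m).filter fun q => 3 ∣ q.1.2 + q.2.2).card =
      2 * ((quadruples m).filter fun q => 3 ∣ q.1.2 + q.2.2 ∧ q.2.2 < q.1.2).card := by
  have h1 : ((quadruples m).filter fun q => 3 ∣ q.1.2 + q.2.2 ∧ q.2.2 < q.1.2).card =
      ((quadruples m).filter fun q => 3 ∣ q.1.2 + q.2.2 ∧ ¬ q.2.2 < q.1.2).card := by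
    refine Finset.card_nbij' Prod.swap Prod.swap ?_ ?_ (fun _ _ => rfl) (fun _ _ => rfl)
    · rintro ⟨⟨a, x⟩, b, y⟩ h
      simp only [Finset.mem_coe, Finset.mem_filter, mem_quadruples, Prod.swap] at h ⊢
      exact ⟨by omega, by omega, by omega⟩
    · rintro ⟨⟨a, x⟩, b, y⟩ h
      simp only [Finset.mem_coe, Finset.mem_filter, mem_quadruples, Prod.swap] at h ⊢
      refine ⟨by omega, by omega, ?_⟩
      by_contra hxy
      obtain rfl : x = y := by omega
      have h3 : 3 ∣ x := by omega
      have : 3 ∣ m := h.1.1 ▸ (h3.mul_left a).add (h3.mul_left b)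
      omega
  rw [two_mul]
  nth_rewrite 2 [h1]
  rw [← Finset.card_filter_add_card_filter_not (fun q => q.2.2 < q.1.2), Finset.filter_filter,
    Finset.filter_filter]

theorem card_quadruples_modEq (m : ℕ) :
    ((quadruples m).filter fun q => q.1.2 ≡ q.2.2 [MOD 3]).card =
      2 * ((quadruples m).filter fun q => q.1.2 ≡ q.2.2 [MOD 3] ∧ q.1.1 < q.2.1).card +
      ((quadruples m).filter fun q => q.1.2 ≡ q.2.2 [MOD 3] ∧ q.1.1 = q.2.1).card := by
  have h1 : ((quadruples m).filter fun q => q.1.2 ≡ q.2.2 [MOD 3] ∧ q.1.1 < q.2.1).card =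
      ((quadruples m).filter fun q => q.1.2 ≡ q.2.2 [MOD 3] ∧ q.2.1 < q.1.1).card := by
    refine Finset.card_nbij' Prod.swap Prod.swap ?_ ?_ (fun _ _ => rfl) (fun _ _ => rfl) <;>
    · rintro ⟨⟨a, x⟩, b, y⟩ h
      simp only [Finset.mem_coe, Finset.mem_filter, mem_quadruples, Prod.swap] at h ⊢
      exact ⟨by omega, h.2.1.symm, h.2.2⟩
  rw [two_mul]
  nth_rewrite 2 [h1]
  rw [← Finset.card_union_of_disjoint, ← Finset.card_union_of_disjoint]
  · congr 1
    ext q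
    simp only [Finset.mem_filter, Finset.mem_union]
    have := lt_trichotomy q.1.1 q.2.1
    tauto
  · refine Finset.disjoint_left.2 fun q h h' => ?_
    simp only [Finset.mem_filter, Finset.mem_union] at h h'
    omega
  · refine Finset.disjoint_left.2 fun q h h' => ?_
    simp only [Finset.mem_filter] at h h'
    omega

/-- The shear is `a x + b y = a (x - y) + (a + b) y`. It turns `3 ∣ x + y` into `x - y ≡ y (mod 3)`,
and `y < x` into `a < a + b`. -/
theorem card_quadruples_shear (m : ℕ) :
    ((quadruples m).filter fun q => 3 ∣ q.1.2 + q.2.2 ∧ q.2.2 < q.1.2).card =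
      ((quadruples m).filter fun q => q.1.2 ≡ q.2.2 [MOD 3] ∧ q.1.1 < q.2.1).card := by
  refine Finset.card_nbij' (fun q => ((q.1.1, q.1.2 - q.2.2), (q.1.1 + q.2.1, q.2.2)))
    (fun q => ((q.1.1, q.1.2 + q.2.2), (q.2.1 - q.1.1, q.2.2))) ?_ ?_ ?_ ?_
  · rintro ⟨⟨a, x⟩, b, y⟩ h
    simp only [Finset.mem_coe, Finset.mem_filter, mem_quadruples] at h ⊢
    simp only [Nat.ModEq] at h ⊢
    obtain ⟨⟨h, h0⟩, h3, hlt⟩ := h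
    obtain ⟨z, rfl⟩ := Nat.exists_eq_add_of_lt hlt
    have e : y + z + 1 - y = z + 1 := by omega
    rw [e]
    exact ⟨⟨by rw [← h]; ring, by omega⟩, by omega, by omega⟩
  · rintro ⟨⟨a, x⟩, b, y⟩ h
    simp only [Finset.mem_coe, Finset.mem_filter, mem_quadruples] at h ⊢
    simp only [Nat.ModEq] at h ⊢
    obtain ⟨⟨h, h0⟩, h3, hlt⟩ := h
    obtain ⟨z, rfl⟩ := Nat.exists_eq_add_of_lt hlt
    have e : a + z + 1 - a = z + 1 := by omega
    rw [e]
    exact ⟨⟨by rw [← h]; ring, by omega⟩, by omega, by omega⟩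
  · rintro ⟨⟨a, x⟩, b, y⟩ h
    simp only [Finset.mem_coe, Finset.mem_filter, mem_quadruples] at h
    simp [Nat.sub_add_cancel h.2.2.le]
  · rintro ⟨⟨a, x⟩, b, y⟩ h
    simp only [Finset.mem_coe, Finset.mem_filter, mem_quadruples] at h
    simp [Nat.add_sub_cancel' h.2.2.le]

/-- Here `χ(x) χ(y) = [x ≡ y] - [3 ∣ x + y]`. The swaps and the shear cancel everything except the
diagonal `a = b`. -/
theorem sum_chiThree_mul_chiThree {m : ℕ} (hm : m % 3 = 2) :
    ∑ q ∈ quadruples m, chiThree q.1.2 * chiThree q.2.2 =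
      ((quadruples m).filter fun q => q.1.2 ≡ q.2.2 [MOD 3] ∧ q.1.1 = q.2.1).card := by
  have h : ∑ q ∈ quadruples m, chiThree q.1.2 * chiThree q.2.2 =
      ((quadruples m).filter fun q => q.1.2 ≡ q.2.2 [MOD 3]).card -
        ((quadruples m).filter fun q => 3 ∣ q.1.2 + q.2.2).card := by
    rw [Finset.card_filter, Finset.card_filter]
    push_cast
    rw [← Finset.sum_sub_distrib]
    refine Finset.sum_congr rfl fun q _ => ?_
    unfold chiThree Nat.ModEq
    split_ifs <;> omega
  rw [h, card_quadruples_modEq, card_quadruples_three_dvd_add hm, card_quadruples_shear]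
  push_cast
  ring

/-- With `x + y = c`, the condition `x ≡ y` says `x ≡ 2c (mod 3)`, a single nonzero class. -/
theorem card_antidiagonal_modEq {c : ℕ} (hc : c % 3 ≠ 0) :
    3 * (((Finset.HasAntidiagonal.antidiagonal c).filter fun s =>
      0 < s.1 ∧ 0 < s.2 ∧ s.1 ≡ s.2 [MOD 3]).card : ℤ) = c - chiThree c := by
  obtain ⟨k, rfl | rfl⟩ : ∃ k, c = 3 * k + 1 ∨ c = 3 * k + 2 := ⟨c / 3, by omega⟩
  · have h : ((Finset.HasAntidiagonal.antidiagonal (3 * k + 1)).filter fun s =>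
        0 < s.1 ∧ 0 < s.2 ∧ s.1 ≡ s.2 [MOD 3]).card = (Finset.range k).card := by
      refine Finset.card_nbij' (fun s => s.1 / 3) (fun i => (3 * i + 2, 3 * k + 1 - (3 * i + 2)))
        ?_ ?_ ?_ ?_
      · rintro ⟨x, y⟩ h
        simp only [Finset.coe_range, Set.mem_Iio, Finset.mem_coe, Finset.mem_filter,
          Finset.HasAntidiagonal.mem_antidiagonal] at h ⊢
        unfold Nat.ModEq at *
        omega
      · intro i h
        simp only [Finset.coe_range, Set.mem_Iio, Finset.mem_coe, Finset.mem_filter,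
          Finset.HasAntidiagonal.mem_antidiagonal] at h ⊢
        unfold Nat.ModEq at *
        omega
      · rintro ⟨x, y⟩ h
        simp only [Finset.mem_coe, Finset.mem_filter, Finset.HasAntidiagonal.mem_antidiagonal,
          Prod.mk.injEq] at h ⊢
        unfold Nat.ModEq at *
        omega
      · intro i h
        simp only []; omega
    rw [h]; simp [chiThree, Nat.add_mod]
  · have h : ((Finset.HasAntidiagonal.antidiagonal (3 * k + 2)).filter fun s =>
        0 < s.1 ∧ 0 < s.2 ∧ s.1 ≡ s.2 [MOD 3]).card = (Finset.range (k + 1)).card := by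
      refine Finset.card_nbij' (fun s => s.1 / 3) (fun i => (3 * i + 1, 3 * k + 2 - (3 * i + 1)))
        ?_ ?_ ?_ ?_
      · rintro ⟨x, y⟩ h
        simp only [Finset.coe_range, Set.mem_Iio, Finset.mem_coe, Finset.mem_filter,
          Finset.HasAntidiagonal.mem_antidiagonal] at h ⊢
        unfold Nat.ModEq at *
        omega
      · intro i h
        simp only [Finset.coe_range, Set.mem_Iio, Finset.mem_coe, Finset.mem_filter,
          Finset.HasAntidiagonal.mem_antidiagonal] at h ⊢
        unfold Nat.ModEq at *
        omega
      · rintro ⟨x, y⟩ h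
        simp only [Finset.mem_coe, Finset.mem_filter, Finset.HasAntidiagonal.mem_antidiagonal,
          Prod.mk.injEq] at h ⊢
        unfold Nat.ModEq at *
        omega
      · intro i h
        simp only []; omega
    rw [h]; simp [chiThree, Nat.add_mod]; ring

/-- On the diagonal `a (x + y) = m`, so `c = x + y` runs over the divisors of `m`. -/
theorem card_quadruples_fst_eq (m : ℕ) (hm : m % 3 = 2) :
    ((quadruples m).filter fun q => q.1.2 ≡ q.2.2 [MOD 3] ∧ q.1.1 = q.2.1).card =
      ∑ c ∈ m.divisors, ((Finset.HasAntidiagonal.antidiagonal c).filter fun s =>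
        0 < s.1 ∧ 0 < s.2 ∧ s.1 ≡ s.2 [MOD 3]).card := by
  rw [← Finset.card_sigma]
  refine Finset.card_nbij' (fun q => ⟨q.1.2 + q.2.2, (q.1.2, q.2.2)⟩)
    (fun t => ((m / t.1, t.2.1), (m / t.1, t.2.2))) ?_ ?_ ?_ ?_
  · rintro ⟨⟨a, x⟩, b, y⟩ h
    simp [mem_quadruples] at h ⊢
    obtain ⟨⟨h, h0⟩, h3, rfl⟩ := h
    exact ⟨⟨⟨a, by rw [← h]; ring⟩, by omega⟩, by omega, by omega, h3⟩
  · rintro ⟨c, x, y⟩ h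
    simp [mem_quadruples] at h ⊢
    obtain ⟨⟨hc, h0⟩, rfl, hx, hy, h3⟩ := h
    have : 0 < m / (x + y) := Nat.div_pos (Nat.le_of_dvd (by omega) hc) (by omega)
    simp only [Nat.div_pos_iff] at this
    exact ⟨⟨by rw [← mul_add, Nat.div_mul_cancel hc], this, hx, this, hy⟩, h3⟩
  · rintro ⟨⟨a, x⟩, b, y⟩ h
    simp [mem_quadruples] at h ⊢
    obtain ⟨⟨h, h0⟩, h3, rfl⟩ := h
    have : m / (x + y) = a := Nat.div_eq_of_eq_mul_left (by omega) (by rw [← h]; ring)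
    exact ⟨this, this⟩
  · rintro ⟨c, x, y⟩ h
    simp at h ⊢
    obtain ⟨_, rfl, _⟩ := h
    simp

/-- The convolution of `chiSum` with itself at `m ≡ 2 (mod 3)` is a third of the divisor sum. -/
theorem three_mul_sum_chiSum {m : ℕ} (hm : m % 3 = 2) :
    3 * ∑ s ∈ Finset.HasAntidiagonal.antidiagonal m, chiSum s.1 * chiSum s.2 = ∑ d ∈ m.divisors, (d : ℤ) := by
  rw [sum_chiSum_mul_chiSum, sum_chiThree_mul_chiThree hm, card_quadruples_fst_eq m hm]
  push_cast
  -- Subtracting `chiSum m = 0` supplies the terms `-χ(c)`, so the two sums agree divisor by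
  -- divisor.
  rw [Finset.mul_sum, ← sub_zero (∑ d ∈ m.divisors, (d : ℤ)), ← chiSum_eq_zero hm, chiSum,
    ← Finset.sum_sub_distrib]
  refine Finset.sum_congr rfl fun c hc => card_antidiagonal_modEq fun h => ?_
  have := (Nat.dvd_of_mod_eq_zero h).trans (Nat.dvd_of_mem_divisors hc)
  omega

/-- In the convolution at `3 n + 2` only the arguments `≡ 1 (mod 3)` contribute. -/
theorem three_mul_sum_chiSum_three_mul_add_one (n : ℕ) :
    3 * ∑ s ∈ Finset.HasAntidiagonal.antidiagonal n, chiSum (3 * s.1 + 1) * chiSum (3 * s.2 + 1) =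
      ∑ d ∈ (3 * n + 2).divisors, (d : ℤ) := by
  rw [← three_mul_sum_chiSum (by omega : (3 * n + 2) % 3 = 2)]
  congr 1
  refine Finset.sum_of_injOn (fun s => (3 * s.1 + 1, 3 * s.2 + 1)) ?_ ?_ ?_ (fun _ _ => rfl)
  · rintro ⟨a, b⟩ _ ⟨c, d⟩ _ h
    simp at h ⊢; exact h
  · rintro ⟨a, b⟩ h
    simp at h ⊢; omega
  · rintro ⟨a, b⟩ h h'
    simp at h h'
    have h1 : a % 3 = 2 ∨ b % 3 = 2 := by
      by_contra hab
      exact h' (a / 3) (b / 3) (by omega) (by omega) (by omega)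
    rcases h1 with h1 | h1 <;> simp [chiSum_eq_zero h1]

/-! ### Representations by the Eisenstein norm -/

/-- The norm form `x² - x y + y²` of the Eisenstein integers. -/
def eisNorm (v : ℤ × ℤ) : ℤ := v.1 ^ 2 - v.1 * v.2 + v.2 ^ 2

/-- Multiplication of Eisenstein integers `x + y ω` in coordinates. -/
def eisMul (v w : ℤ × ℤ) : ℤ × ℤ := (v.1 * w.1 - v.2 * w.2, v.1 * w.2 + v.2 * w.1 - v.2 * w.2)

/-- Conjugation of Eisenstein integers in coordinates. -/
def eisConj (v : ℤ × ℤ) : ℤ × ℤ := (v.1 - v.2, -v.2)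

theorem eisNorm_mul (v w : ℤ × ℤ) : eisNorm (eisMul v w) = eisNorm v * eisNorm w := by
  simp only [eisNorm, eisMul]; ring

theorem eisNorm_conj (v : ℤ × ℤ) : eisNorm (eisConj v) = eisNorm v := by
  simp only [eisNorm, eisConj]; ring

theorem eisMul_conj_mul (v w : ℤ × ℤ) : eisMul (eisMul v (eisConj w)) w = eisNorm w • v := by
  ext <;> simp only [eisNorm, eisMul, eisConj, Prod.smul_fst, Prod.smul_snd, smul_eq_mul] <;> ring

theorem eisMul_mul_conj (v w : ℤ × ℤ) : eisMul (eisMul v w) (eisConj w) = eisNorm w • v := by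
  ext <;> simp only [eisNorm, eisMul, eisConj, Prod.smul_fst, Prod.smul_snd, smul_eq_mul] <;> ring

theorem eisMul_smul (c : ℤ) (v w : ℤ × ℤ) : eisMul (c • v) w = c • eisMul v w := by
  ext <;> simp only [eisMul, Prod.smul_fst, Prod.smul_snd, smul_eq_mul] <;> ring

theorem eisNorm_smul (c : ℤ) (v : ℤ × ℤ) : eisNorm (c • v) = c ^ 2 * eisNorm v := by
  simp only [eisNorm, Prod.smul_fst, Prod.smul_snd, smul_eq_mul]; ring

theorem smul_int_prod_injective {c : ℤ} (hc : c ≠ 0) :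
    Function.Injective fun v : ℤ × ℤ => c • v := by
  rintro ⟨a, b⟩ ⟨a', b'⟩ h
  simp only [Prod.smul_mk, smul_eq_mul, Prod.mk.injEq] at h
  exact Prod.ext (mul_left_cancel₀ hc h.1) (mul_left_cancel₀ hc h.2)

theorem eisMul_right_injective {w : ℤ × ℤ} (hw : eisNorm w ≠ 0) :
    Function.Injective fun v => eisMul v w := by
  intro v v' h
  have := congrArg (fun u => eisMul u (eisConj w)) h
  simp only [eisMul_mul_conj] at this
  exact smul_int_prod_injective hw this

/-- The representations of `n` by the norm form. -/
def eisReps (n : ℤ) : Set (ℤ × ℤ) := {v | eisNorm v = n}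

theorem mem_eisReps {n : ℤ} {v : ℤ × ℤ} : v ∈ eisReps n ↔ eisNorm v = n := Iff.rfl

theorem finite_eisReps (n : ℤ) : (eisReps n).Finite := by
  refine (((Set.finite_Icc (-(2 * |n|)) (2 * |n|))).prod
    (Set.finite_Icc (-(2 * |n|)) (2 * |n|))).subset ?_
  rintro ⟨x, y⟩ h
  rw [mem_eisReps, eisNorm] at h
  dsimp only at h
  have h0 : 0 ≤ n := by nlinarith [sq_nonneg (2 * x - y), sq_nonneg y]
  have hn : n ≤ n ^ 2 := by
    rcases h0.eq_or_lt with h0 | h0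
    · simp [← h0]
    · nlinarith
  have hx : |x| ≤ |2 * n| := sq_le_sq.1 (by nlinarith [sq_nonneg (2 * y - x)])
  have hy : |y| ≤ |2 * n| := sq_le_sq.1 (by nlinarith [sq_nonneg (2 * x - y)])
  rw [abs_mul, abs_two] at hx hy
  exact ⟨abs_le.1 hx, abs_le.1 hy⟩

/-- Inert primes: if `y` were invertible mod `p`, then `-x/y` would be a root of `t² + t + 1`, a
cube root of unity. As `3 ∤ p - 1` it equals 1, which forces `p = 3`. -/
theorem dvd_of_dvd_eisNorm {p : ℕ} (hp : p.Prime) (hp2 : p % 3 = 2) {v : ℤ × ℤ}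
    (h : (p : ℤ) ∣ eisNorm v) : (p : ℤ) ∣ v.1 ∧ (p : ℤ) ∣ v.2 := by
  have := Fact.mk hp
  obtain ⟨x, y⟩ := v
  simp only [eisNorm, ← ZMod.intCast_zmod_eq_zero_iff_dvd] at h ⊢
  push_cast at h
  generalize (x : ZMod p) = a at *
  generalize (y : ZMod p) = b at *
  have hb : b = 0 := by
    by_contra hb
    have hc : (-a / b) ^ 3 = 1 := by
      rw [div_pow, div_eq_one_iff_eq (pow_ne_zero _ hb)]
      linear_combination -(a + b) * h
    have hz : -a / b ≠ 0 := by
      intro h0; rw [h0] at hc; norm_num at hc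
    have h1 : -a / b = 1 := by
      have hf := ZMod.pow_card_sub_one_eq_one hz
      have hg : orderOf (-a / b) ∣ 1 := by
        have hcop : Nat.gcd 3 (p - 1) = 1 := by
          rw [← Nat.coprime_iff_gcd_eq_one, Nat.Prime.coprime_iff_not_dvd Nat.prime_three]
          have := hp.pos
          omega
        rw [← hcop]
        exact Nat.dvd_gcd (orderOf_dvd_of_pow_eq_one hc) (orderOf_dvd_of_pow_eq_one hf)
      exact orderOf_eq_one_iff.1 (Nat.dvd_one.1 hg)
    rw [div_eq_one_iff_eq hb] at h1
    have h3 : (3 : ZMod p) * b ^ 2 = 0 := by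
      rw [← h, ← h1]; ring
    have h3' : ((3 : ℕ) : ZMod p) = 0 := by
      exact_mod_cast (mul_eq_zero.1 h3).resolve_right (pow_ne_zero _ hb)
    rw [ZMod.natCast_eq_zero_iff] at h3'
    have := (Nat.prime_dvd_prime_iff_eq hp Nat.prime_three).1 h3'
    omega
  subst hb
  exact ⟨by simpa using h, rfl⟩

theorem exists_sq_add_self_add_one {p : ℕ} (hp : p.Prime) (hp1 : p % 3 = 1) :
    ∃ t : ZMod p, t ^ 2 + t + 1 = 0 := by
  have := Fact.mk hp
  have hd : 3 ∣ Fintype.card (ZMod p)ˣ := by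
    rw [ZMod.card_units]; have := hp.pos; omega
  have := Fact.mk Nat.prime_three
  obtain ⟨u, hu⟩ := exists_prime_orderOf_dvd_card 3 hd
  have h3 : (u : ZMod p) ^ 3 = 1 := by
    rw [← Units.val_pow_eq_pow_val, ← hu, pow_orderOf_eq_one, Units.val_one]
  refine ⟨u, (mul_eq_zero.1 (?_ : ((u : ZMod p) - 1) * _ = 0)).resolve_left fun h => ?_⟩
  · linear_combination h3
  · have : u = 1 := Units.ext (sub_eq_zero.1 h)
    simp [this] at hu

/-- Thue's argument: pigeonhole on `a + t b` with `0 ≤ a, b ≤ √p` yields a small nonzero vector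
whose norm is a multiple of `p` below `3p`. -/
theorem exists_eisNorm_eq_prime {p : ℕ} (hp : p.Prime) (hp1 : p % 3 = 1) :
    ∃ w, eisNorm w = p := by
  obtain ⟨t, ht⟩ := exists_sq_add_self_add_one hp hp1
  have := Fact.mk hp
  set s := Nat.sqrt p
  have hlt : Fintype.card (ZMod p) < Fintype.card (Fin (s + 1) × Fin (s + 1)) := by
    simp only [ZMod.card, Fintype.card_prod, Fintype.card_fin]
    exact Nat.lt_succ_sqrt p
  obtain ⟨⟨a, b⟩, ⟨a', b'⟩, hne, heq⟩ := Fintype.exists_ne_map_eq_of_card_lt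
    (fun v : Fin (s + 1) × Fin (s + 1) => ((v.1 : ℕ) : ZMod p) + t * ((v.2 : ℕ) : ZMod p)) hlt
  dsimp only at heq
  have ha := a.is_lt
  have hb := b.is_lt
  have ha' := a'.is_lt
  have hb' := b'.is_lt
  set x : ℤ := (a : ℕ) - (a' : ℕ) with hx
  set y : ℤ := (b : ℕ) - (b' : ℕ) with hy
  have hxy : ¬ (x = 0 ∧ y = 0) := by
    rintro ⟨h1, h2⟩
    apply hne
    ext <;> simp only <;> omega
  have hdvd : (p : ℤ) ∣ x ^ 2 - x * y + y ^ 2 := by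
    rw [← ZMod.intCast_zmod_eq_zero_iff_dvd]
    have h1 : (x : ZMod p) = - t * (y : ZMod p) := by
      rw [hx, hy]; push_cast; linear_combination heq
    push_cast
    rw [h1]
    linear_combination (y : ZMod p) ^ 2 * ht
  have hs : (s : ℤ) ^ 2 < p := by
    have h1 : s * s ≤ p := Nat.sqrt_le p
    have h2 : s * s ≠ p := fun h => hp.not_isSquare ⟨s, h.symm⟩
    have : s * s < p := by omega
    rw [sq]; exact_mod_cast this
  have hx2 : x ^ 2 ≤ (s : ℤ) ^ 2 := sq_le_sq' (by omega) (by omega)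
  have hy2 : y ^ 2 ≤ (s : ℤ) ^ 2 := sq_le_sq' (by omega) (by omega)
  obtain ⟨c, hc⟩ := hdvd
  have hp0 : (0 : ℤ) < p := by exact_mod_cast hp.pos
  have hpos : 0 < x ^ 2 - x * y + y ^ 2 := by
    rcases not_and_or.1 hxy with h | h
    · nlinarith [sq_nonneg (2 * y - x), (sq_pos_iff (a := x)).2 h]
    · nlinarith [sq_nonneg (2 * x - y), (sq_pos_iff (a := y)).2 h]
  have hc0 : 0 < c := by
    by_contra h; nlinarith
  have hc3 : c < 3 := by
    by_contra h
    nlinarith [sq_nonneg (x + y)]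
  obtain rfl | rfl : c = 1 ∨ c = 2 := by omega
  · exact ⟨(x, y), by rw [eisNorm]; simpa using hc⟩
  -- Norm `2p` is impossible: an even norm forces both coordinates even, so `4` would divide `2p`
  -- with `p` odd.
  · exfalso
    have hpo : (p : ℤ) % 2 = 1 := by
      rcases hp.eq_two_or_odd with h | h <;> omega
    obtain ⟨x', hx' | hx'⟩ := x.even_or_odd' <;> obtain ⟨y', hy' | hy'⟩ := y.even_or_odd' <;>
      rw [hx', hy'] at hc <;> ring_nf at hc <;> omega

/-- The quotient is `v w̄ / p`. The hypothesis gives divisibility of the second coordinate of `v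
w̄`; that of the first follows because `v w̄` has norm `p² m`. -/
theorem exists_eisMul_eq {p : ℕ} (hp : p.Prime) {v w : ℤ × ℤ} {m : ℤ} (hw : eisNorm w = p)
    (hv : eisNorm v = p * m) (h : (p : ℤ) ∣ v.2 * w.1 - v.1 * w.2) :
    ∃ u ∈ eisReps m, eisMul u w = v := by
  have hp' := Nat.prime_iff_prime_int.1 hp
  have hN := eisNorm_mul v (eisConj w)
  rw [eisNorm_conj, hv, hw] at hN
  have h2 : (eisMul v (eisConj w)).2 = v.2 * w.1 - v.1 * w.2 := by
    simp only [eisMul, eisConj]; ring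
  rw [← h2] at h
  have h1 : (p : ℤ) ∣ (eisMul v (eisConj w)).1 := by
    refine hp'.dvd_of_dvd_pow (n := 2) ?_
    obtain ⟨c, hc⟩ := h
    rw [eisNorm, hc] at hN
    exact ⟨p * m + (eisMul v (eisConj w)).1 * c - p * c ^ 2, by linear_combination hN⟩
  obtain ⟨X, hX⟩ := h1
  obtain ⟨Y, hY⟩ := h
  have hu : eisMul v (eisConj w) = (p : ℤ) • (X, Y) := by
    ext <;> simp [hX, hY]
  refine ⟨(X, Y), ?_, ?_⟩
  · rw [hu, eisNorm_smul] at hN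
    have : (p : ℤ) ^ 2 ≠ 0 := pow_ne_zero _ hp'.ne_zero
    exact mul_left_cancel₀ this (by rw [hN]; ring)
  · apply smul_int_prod_injective hp'.ne_zero
    dsimp only
    rw [← eisMul_smul, ← hu, eisMul_conj_mul, hw]

/-- The set on the right plays the role of the representations of `m / p`; it is empty when `p ∤ m`.
-/
theorem ncard_eisReps_of_mod_two {p : ℕ} (hp : p.Prime) (hp2 : p % 3 = 2) (m : ℤ) :
    (eisReps (p * m)).ncard = {v | p * eisNorm v = m}.ncard := by
  have hp0 : (p : ℤ) ≠ 0 := by exact_mod_cast hp.ne_zero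
  rw [← Set.ncard_image_of_injective {v | (p : ℤ) * eisNorm v = m} (smul_int_prod_injective hp0)]
  congr 1
  ext v
  simp only [mem_eisReps, Set.mem_image, Set.mem_ofPred_eq]
  constructor
  · intro h
    obtain ⟨⟨a, ha⟩, b, hb⟩ := dvd_of_dvd_eisNorm hp hp2 (h ▸ dvd_mul_right _ _)
    have hv : (p : ℤ) • (a, b) = v := by ext <;> simp [ha, hb]
    refine ⟨(a, b), mul_left_cancel₀ hp0 ?_, hv⟩
    rw [← h, ← hv, eisNorm_smul]; ring
  · rintro ⟨u, hu, rfl⟩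
    rw [eisNorm_smul, ← hu]; ring

/-- Split primes `p = w w̄`: an element of norm `p m` is divisible by `w` or by `w̄`, and by both
exactly when divisible by `p`. Inclusion-exclusion gives the count. -/
theorem ncard_eisReps_of_mod_one {p : ℕ} (hp : p.Prime) (hp1 : p % 3 = 1) (m : ℤ) :
    (eisReps (p * m)).ncard + {v | p * eisNorm v = m}.ncard = 2 * (eisReps m).ncard := by
  have hp' := Nat.prime_iff_prime_int.1 hp
  have hp0 := hp'.ne_zero
  obtain ⟨w, hw⟩ := exists_eisNorm_eq_prime hp hp1
  have hw0 : eisNorm w ≠ 0 := hw ▸ hp0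
  have hw' : eisNorm (eisConj w) = p := by rw [eisNorm_conj, hw]
  have hunion : eisReps (p * m) =
      (fun v => eisMul v w) '' eisReps m ∪ (fun v => eisMul v (eisConj w)) '' eisReps m := by
    ext v
    constructor
    · intro hv
      -- The factors are the second coordinates of `v w̄` and `v w`.
      have : (p : ℤ) ∣ (v.2 * w.1 - v.1 * w.2) * (v.2 * (w.1 - w.2) - v.1 * -w.2) := by
        rw [mem_eisReps] at hv
        refine ⟨v.2 ^ 2 - w.2 ^ 2 * m, ?_⟩
        simp only [eisNorm] at hv hw
        linear_combination v.2 ^ 2 * hw - w.2 ^ 2 * hv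
      rcases hp'.dvd_or_dvd this with h | h
      · exact Or.inl (exists_eisMul_eq hp hw hv h)
      · exact Or.inr (exists_eisMul_eq hp hw' hv h)
    · rintro (⟨u, hu, rfl⟩ | ⟨u, hu, rfl⟩) <;>
      · rw [mem_eisReps] at hu ⊢
        simp only [eisNorm_mul, hu, hw, hw', mul_comm]
  have hinter : (fun v => eisMul v w) '' eisReps m ∩ (fun v => eisMul v (eisConj w)) '' eisReps m =
      (fun v => (p : ℤ) • v) '' {v | p * eisNorm v = m} := by
    ext v
    constructor
    · rintro ⟨⟨u, hu, huv⟩, u', hu', huv'⟩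
      have hN : eisNorm v = p * m := by
        rw [mem_eisReps] at hu
        rw [← huv]; simp only [eisNorm_mul, hu, hw, mul_comm]
      have h1 : (p : ℤ) ∣ v.2 * w.1 - v.1 * w.2 := by
        refine ⟨u.2, ?_⟩
        rw [← huv, ← hw]; simp only [eisMul, eisNorm]; ring
      have h2 : (p : ℤ) ∣ v.2 * (w.1 - w.2) + v.1 * w.2 := by
        refine ⟨u'.2, ?_⟩
        rw [← huv', ← hw]; simp only [eisMul, eisNorm, eisConj]; ring
      have hsq : ¬ (p : ℤ) ^ 2 ∣ p := by
        intro h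
        have : p ^ 2 ∣ p := by exact_mod_cast h
        have := Nat.le_of_dvd hp.pos this
        nlinarith [hp.one_lt]
      have hb : ¬ (p : ℤ) ∣ w.2 := by
        rintro ⟨b, hb⟩
        have ha : (p : ℤ) ∣ w.1 := by
          refine hp'.dvd_of_dvd_pow (n := 2) ⟨1 + w.1 * b - b * w.2, ?_⟩
          rw [eisNorm] at hw
          linear_combination hw + (w.1 - w.2) * hb
        obtain ⟨a, ha⟩ := ha
        apply hsq
        rw [eisNorm, ha, hb] at hw
        exact ⟨a ^ 2 - a * b + b ^ 2, by linear_combination -hw⟩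
      -- By `4 N(w) = (2 w₁ - w₂)² + 3 w₂²`. Adding `h1` and `h2` gives `p ∣ v₂ (2 w₁ - w₂)`.
      have hab : ¬ (p : ℤ) ∣ 2 * w.1 - w.2 := by
        rintro ⟨c, hc⟩
        have h3 : (p : ℤ) ∣ 3 * w.2 ^ 2 := by
          refine ⟨4 - c * (2 * w.1 - w.2), ?_⟩
          rw [eisNorm] at hw
          linear_combination 4 * hw - (2 * w.1 - w.2) * hc
        rcases hp'.dvd_or_dvd h3 with h3 | h3
        · have h3' : p ∣ 3 := by exact_mod_cast h3
          have := (Nat.prime_dvd_prime_iff_eq hp Nat.prime_three).1 h3'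
          omega
        · exact hb (hp'.dvd_of_dvd_pow h3)
      have hy : (p : ℤ) ∣ v.2 := by
        have : (p : ℤ) ∣ v.2 * (2 * w.1 - w.2) := by
          rw [show v.2 * (2 * w.1 - w.2) =
            (v.2 * w.1 - v.1 * w.2) + (v.2 * (w.1 - w.2) + v.1 * w.2) by ring]
          exact h1.add h2
        exact (hp'.dvd_or_dvd this).resolve_right hab
      have hx : (p : ℤ) ∣ v.1 := by
        have : (p : ℤ) ∣ v.1 * w.2 := by
          rw [show v.1 * w.2 = v.2 * w.1 - (v.2 * w.1 - v.1 * w.2) by ring]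
          exact (hy.mul_right w.1).sub h1
        exact (hp'.dvd_or_dvd this).resolve_right hb
      obtain ⟨a, ha⟩ := hx
      obtain ⟨b, hb⟩ := hy
      have hv : (p : ℤ) • (a, b) = v := by ext <;> simp [ha, hb]
      refine ⟨(a, b), mul_left_cancel₀ hp0 ?_, hv⟩
      rw [← hN, ← hv, eisNorm_smul]; ring
    · rintro ⟨u, hu, rfl⟩
      rw [Set.mem_ofPred_eq] at hu
      refine ⟨⟨eisMul u (eisConj w), ?_, ?_⟩, ⟨eisMul u w, ?_, ?_⟩⟩
      · rw [mem_eisReps, eisNorm_mul, hw', mul_comm, hu]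
      · dsimp only; rw [eisMul_conj_mul, hw]
      · rw [mem_eisReps, eisNorm_mul, hw, mul_comm, hu]
      · dsimp only; rw [eisMul_mul_conj, hw]
  have h := Set.ncard_union_add_ncard_inter ((fun v => eisMul v w) '' eisReps m)
    ((fun v => eisMul v (eisConj w)) '' eisReps m)
    ((finite_eisReps m).image _) ((finite_eisReps m).image _)
  rw [← hunion, hinter, Set.ncard_image_of_injective _ (smul_int_prod_injective hp0),
    Set.ncard_image_of_injective _ (eisMul_right_injective hw0),
    Set.ncard_image_of_injective _ (eisMul_right_injective (hw' ▸ hp0))] at h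
  rw [h]; ring

/-- Both splitting types in one recurrence, `r(pm) + χ(p) r(m/p) = (1 + χ(p)) r(m)`, which `chiSum`
also satisfies. -/
theorem ncard_eisReps_prime_mul {p : ℕ} (hp : p.Prime) (hp3 : p % 3 ≠ 0) (m : ℤ) :
    ((eisReps (p * m)).ncard : ℤ) + chiThree p * {v | p * eisNorm v = m}.ncard =
      (1 + chiThree p) * (eisReps m).ncard := by
  obtain h | h : p % 3 = 1 ∨ p % 3 = 2 := by omega
  · have := ncard_eisReps_of_mod_one hp h m
    simp only [chiThree, h, if_true]
    push_cast [← @Nat.cast_inj ℤ] at this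
    linarith
  · simp [chiThree, h, ncard_eisReps_of_mod_two hp h m]

/-- The divisors of `p m` are those of `m` together with their `p`-multiples; the overlap consists
of the divisors of `m` divisible by `p`. -/
theorem chiSum_prime_mul {p : ℕ} (hp : p.Prime) {m : ℕ} (hm : m ≠ 0) :
    chiSum (p * m) + ∑ d ∈ m.divisors.filter (p ∣ ·), chiThree d =
      (1 + chiThree p) * chiSum m := by
  have hi : m.divisors ∩ m.divisors.image (p * ·) = m.divisors.filter (p ∣ ·) := by
    ext d
    simp only [Finset.mem_inter, Finset.mem_image, Nat.mem_divisors, Finset.mem_filter]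
    constructor
    · rintro ⟨h, e, he, rfl⟩
      exact ⟨h, dvd_mul_right _ _⟩
    · rintro ⟨h, e, rfl⟩
      exact ⟨h, e, ⟨(dvd_mul_left _ _).trans h.1, hm⟩, rfl⟩
  have hu : m.divisors ∪ m.divisors.image (p * ·) = (p * m).divisors := by
    ext d
    simp only [Finset.mem_union, Finset.mem_image, Nat.mem_divisors]
    constructor
    · rintro (h | ⟨e, he, rfl⟩)
      · exact ⟨h.1.mul_left p, mul_ne_zero hp.ne_zero hm⟩
      · exact ⟨mul_dvd_mul_left p he.1, mul_ne_zero hp.ne_zero hm⟩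
    · rintro ⟨h, -⟩
      by_cases hd : p ∣ d
      · obtain ⟨e, rfl⟩ := hd
        exact Or.inr ⟨e, ⟨Nat.dvd_of_mul_dvd_mul_left hp.pos h, hm⟩, rfl⟩
      · exact Or.inl ⟨((hp.coprime_iff_not_dvd.2 hd).symm).dvd_of_dvd_mul_left h, hm⟩
  rw [chiSum, ← hu, ← hi, Finset.sum_union_inter, Finset.sum_image
    fun a _ b _ h => Nat.eq_of_mul_eq_mul_left hp.pos h]
  simp only [chiThree_mul, ← Finset.mul_sum, chiSum]
  ring

theorem ncard_eisReps_one : (eisReps 1).ncard = 6 := by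
  have h : eisReps 1 =
      (({(1, 0), (-1, 0), (0, 1), (0, -1), (1, 1), (-1, -1)} : Finset (ℤ × ℤ)) : Set (ℤ × ℤ)) := by
    ext ⟨x, y⟩
    simp only [mem_eisReps, eisNorm, Finset.coe_insert, Finset.coe_singleton,
      Set.mem_insert_iff, Set.mem_singleton_iff, Prod.mk.injEq]
    constructor
    · intro h
      have hx : |x| < 2 := by
        refine abs_lt_of_sq_lt_sq (by nlinarith [sq_nonneg (2 * y - x)]) (by norm_num)
      have hy : |y| < 2 := by
        refine abs_lt_of_sq_lt_sq (by nlinarith [sq_nonneg (2 * x - y)]) (by norm_num)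
      rw [abs_lt] at hx hy
      obtain ⟨hx1, hx2⟩ := hx
      obtain ⟨hy1, hy2⟩ := hy
      interval_cases x <;> interval_cases y <;> simp_all
    · rintro (⟨rfl, rfl⟩ | ⟨rfl, rfl⟩ | ⟨rfl, rfl⟩ | ⟨rfl, rfl⟩ | ⟨rfl, rfl⟩ | ⟨rfl, rfl⟩) <;> norm_num
  rw [h, Set.ncard_coe_finset]
  rfl

theorem sum_chiThree_filter_dvd {p m : ℕ} (hp : p.Prime) (hm : m ≠ 0) :
    ∑ d ∈ (p * m).divisors.filter (p ∣ ·), chiThree d = chiThree p * chiSum m := by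
  have : (p * m).divisors.filter (p ∣ ·) = m.divisors.image (p * ·) := by
    ext d
    simp only [Finset.mem_filter, Nat.mem_divisors, Finset.mem_image]
    constructor
    · rintro ⟨⟨h, -⟩, e, rfl⟩
      exact ⟨e, ⟨Nat.dvd_of_mul_dvd_mul_left hp.pos h, hm⟩, rfl⟩
    · rintro ⟨e, he, rfl⟩
      exact ⟨⟨mul_dvd_mul_left p he.1, mul_ne_zero hp.ne_zero hm⟩, dvd_mul_right _ _⟩
  rw [this, Finset.sum_image fun a _ b _ h => Nat.eq_of_mul_eq_mul_left hp.pos h, chiSum,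
    Finset.mul_sum]
  simp only [chiThree_mul]

/-- The number of representations by the norm form, for arguments prime to `3`. -/
theorem ncard_eisReps (m : ℕ) (hm : m % 3 ≠ 0) : ((eisReps m).ncard : ℤ) = 6 * chiSum m := by
  induction m using Nat.strong_induction_on with
  | _ m ih =>
    by_cases h1 : m = 1
    · subst h1
      rw [Nat.cast_one, ncard_eisReps_one]
      simp [chiSum, chiThree]
    -- Strip one prime and compare the two recurrences; the factor 6 comes from the six units.
    obtain ⟨p, hp, m, rfl⟩ := Nat.exists_prime_and_dvd h1
    have hp3 : p % 3 ≠ 0 := fun h => hm (by simp [Nat.mul_mod, h])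
    have hm3 : m % 3 ≠ 0 := fun h => hm (by simp [Nat.mul_mod, h])
    have hm0 : m ≠ 0 := by rintro rfl; simp at hm3
    have hlt : m < p * m := by nlinarith [hp.two_le, Nat.pos_of_ne_zero hm0]
    have hr := ncard_eisReps_prime_mul hp hp3 m
    have hc := chiSum_prime_mul hp hm0
    rw [ih m hlt hm3] at hr
    push_cast
    by_cases hpm : p ∣ m
    · obtain ⟨k, rfl⟩ := hpm
      have hk3 : k % 3 ≠ 0 := fun h => hm3 (by simp [Nat.mul_mod, h])
      have hk0 : k ≠ 0 := by rintro rfl; simp at hk3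
      rw [sum_chiThree_filter_dvd hp hk0] at hc
      have hset : {v | (p : ℤ) * eisNorm v = ((p * k : ℕ) : ℤ)} = eisReps k := by
        ext v
        have : (p : ℤ) ≠ 0 := by exact_mod_cast hp.ne_zero
        rw [mem_eisReps, Set.mem_ofPred_eq, Nat.cast_mul, mul_right_inj' this]
      rw [hset, ih k (by nlinarith [hp.two_le, Nat.pos_of_ne_zero hk0]) hk3] at hr
      linear_combination hr - 6 * hc
    · have hset : {v | (p : ℤ) * eisNorm v = (m : ℤ)} = ∅ := by
        ext v
        simp only [Set.mem_ofPred_eq, Set.mem_empty_iff_false, iff_false]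
        intro h
        exact hpm (by exact_mod_cast Dvd.intro _ h)
      have hf : m.divisors.filter (p ∣ ·) = ∅ := by
        refine Finset.filter_eq_empty_iff.2 fun d hd h => hpm (h.trans (Nat.dvd_of_mem_divisors hd))
      rw [hset, Set.ncard_empty] at hr
      rw [hf, Finset.sum_empty] at hc
      push_cast at hr
      linear_combination hr - 6 * hc

/-! ### From norm `3n+1` to core parameters -/

/-- The parameters `(A, B)` of the `3`-cores of `n`. -/
def coreParams (n : ℕ) : Set (ℕ × ℕ) := {v | v.1 ^ 2 + v.2 ^ 2 + v.2 = n + v.1 * v.2}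

/-- The integer solutions of the equation that defines `coreParams`. -/
def coreParamsInt (n : ℕ) : Set (ℤ × ℤ) := {v | v.1 ^ 2 + v.2 ^ 2 + v.2 = n + v.1 * v.2}

/-- Norm `3n+1` forces `x + y ≡ ±1 (mod 3)`. The class `+1` is parametrized by `x + y = 3a + 1`;
negation gives the other. -/
theorem eisReps_eq_union (n : ℕ) :
    eisReps (3 * n + 1) = (fun v => (2 * v.1 - v.2, v.1 + v.2 + 1)) '' coreParamsInt n ∪
      (fun v => (-(2 * v.1 - v.2), -(v.1 + v.2 + 1))) '' coreParamsInt n := by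
  ext ⟨x, y⟩
  simp only [mem_eisReps, eisNorm, coreParamsInt, Set.mem_union, Set.mem_image, Set.mem_ofPred_eq,
    Prod.exists, Prod.mk.injEq]
  constructor
  · intro h
    have h3 : (3 : ℤ) ∣ (x + y - 1) * (x + y + 1) := ⟨n + x * y, by linear_combination h⟩
    rcases Int.prime_three.dvd_or_dvd h3 with ⟨a, ha⟩ | ⟨a, ha⟩
    · obtain rfl : x = 3 * a + 1 - y := by linarith
      exact Or.inl ⟨a, y - a - 1, by linarith, by ring, by ring⟩
    · obtain rfl : x = 3 * a - 1 - y := by linarith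
      exact Or.inr ⟨-a, -y + a - 1, by linarith, by ring, by ring⟩
  · rintro (⟨a, b, h, rfl, rfl⟩ | ⟨a, b, h, rfl, rfl⟩) <;> linear_combination 3 * h

theorem ncard_eisReps_eq_two_mul (n : ℕ) :
    (eisReps (3 * n + 1)).ncard = 2 * (coreParamsInt n).ncard := by
  have hf : Function.Injective fun v : ℤ × ℤ => (2 * v.1 - v.2, v.1 + v.2 + 1) := by
    rintro ⟨a, b⟩ ⟨c, d⟩ h
    simp only [Prod.mk.injEq] at h ⊢
    omega
  have hg : Function.Injective fun v : ℤ × ℤ => (-(2 * v.1 - v.2), -(v.1 + v.2 + 1)) := by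
    rintro ⟨a, b⟩ ⟨c, d⟩ h
    simp only [Prod.mk.injEq] at h ⊢
    omega
  have hfin := finite_eisReps (3 * n + 1)
  rw [eisReps_eq_union] at hfin ⊢
  rw [Set.ncard_union_eq ?_ (hfin.subset Set.subset_union_left)
    (hfin.subset Set.subset_union_right), Set.ncard_image_of_injective _ hf,
    Set.ncard_image_of_injective _ hg, two_mul]
  refine Set.disjoint_left.2 ?_
  rintro _ ⟨⟨a, b⟩, -, rfl⟩ ⟨⟨c, d⟩, -, h⟩
  simp only [Prod.mk.injEq] at h
  omega

/-- Multiplication by `ω` becomes the order-three affine map `(a, b) ↦ (-b-1, a-b-1)`, which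
preserves the equation. The images of the quadrant `a, b ≥ 0` under its powers tile the lattice. -/
theorem coreParamsInt_eq_union (n : ℕ) :
    coreParamsInt n = (fun v : ℕ × ℕ => ((v.1 : ℤ), (v.2 : ℤ))) '' coreParams n ∪
      ((fun v : ℕ × ℕ => (-(v.2 : ℤ) - 1, (v.1 : ℤ) - v.2 - 1)) '' coreParams n ∪
      (fun v : ℕ × ℕ => ((v.2 : ℤ) - v.1, -(v.1 : ℤ) - 1)) '' coreParams n) := by
  ext ⟨x, y⟩
  simp only [coreParams, coreParamsInt, Set.mem_union, Set.mem_image, Set.mem_ofPred_eq,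
    Prod.exists, Prod.mk.injEq, ← @Nat.cast_inj ℤ]
  push_cast
  constructor
  · intro h
    by_cases hpos : 0 ≤ x ∧ 0 ≤ y
    · obtain ⟨hx, hy⟩ := hpos
      lift x to ℕ using hx
      lift y to ℕ using hy
      exact Or.inl ⟨x, y, h, rfl, rfl⟩
    rcases le_or_gt x y with hxy | hxy
    · obtain ⟨a, rfl⟩ : ∃ a : ℕ, x = -a - 1 := ⟨(-x - 1).toNat, by omega⟩
      obtain ⟨b, rfl⟩ : ∃ b : ℕ, y = b - a - 1 := ⟨(y + a + 1).toNat, by omega⟩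
      exact Or.inr (Or.inl ⟨b, a, by linarith, by ring, by ring⟩)
    · obtain ⟨a, rfl⟩ : ∃ a : ℕ, y = -a - 1 := ⟨(-y - 1).toNat, by omega⟩
      obtain ⟨b, rfl⟩ : ∃ b : ℕ, x = b - a := ⟨(x + a).toNat, by omega⟩
      exact Or.inr (Or.inr ⟨a, b, by linarith, by ring, by ring⟩)
  · rintro (⟨a, b, h, rfl, rfl⟩ | ⟨a, b, h, rfl, rfl⟩ | ⟨a, b, h, rfl, rfl⟩) <;>
      linear_combination h

theorem ncard_coreParamsInt (n : ℕ) : (coreParamsInt n).ncard = 3 * (coreParams n).ncard := by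
  have hfin : (coreParamsInt n).Finite := by
    have := finite_eisReps (3 * n + 1)
    rw [eisReps_eq_union] at this
    refine Set.Finite.of_finite_image (this.subset Set.subset_union_left) ?_
    rintro ⟨a, b⟩ _ ⟨c, d⟩ _ h
    simp only [Prod.mk.injEq] at h ⊢
    omega
  rw [coreParamsInt_eq_union] at hfin ⊢
  have h1 := hfin.subset Set.subset_union_left
  have h23 := hfin.subset Set.subset_union_right
  rw [Set.ncard_union_eq ?_ h1 h23, Set.ncard_union_eq ?_ (h23.subset Set.subset_union_left)
    (h23.subset Set.subset_union_right), Set.ncard_image_of_injective,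
    Set.ncard_image_of_injective, Set.ncard_image_of_injective]
  · ring
  · rintro ⟨a, b⟩ ⟨c, d⟩ h
    simp only [Prod.mk.injEq] at h ⊢
    omega
  · rintro ⟨a, b⟩ ⟨c, d⟩ h
    simp only [Prod.mk.injEq] at h ⊢
    omega
  · rintro ⟨a, b⟩ ⟨c, d⟩ h
    simp only [Prod.mk.injEq] at h ⊢
    omega
  · refine Set.disjoint_left.2 ?_
    rintro _ ⟨⟨a, b⟩, -, rfl⟩ ⟨⟨c, d⟩, -, h⟩
    simp only [Prod.mk.injEq] at h
    omega
  · refine Set.disjoint_left.2 ?_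
    rintro _ ⟨⟨a, b⟩, -, rfl⟩ (⟨⟨c, d⟩, -, h⟩ | ⟨⟨c, d⟩, -, h⟩) <;>
    · simp only [Prod.mk.injEq] at h
      omega

/-- The number of parameters of `3`-cores of `n` as a divisor sum. -/
theorem ncard_coreParams (n : ℕ) : ((coreParams n).ncard : ℤ) = chiSum (3 * n + 1) := by
  have h := ncard_eisReps (3 * n + 1) (by omega)
  push_cast at h
  rw [ncard_eisReps_eq_two_mul, ncard_coreParamsInt] at h
  push_cast at h
  linarith

/-! ### Beta-sets and hook numbers -/

/-- The set of first column hook lengths of the partition with the given parts. -/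
def List.betaSet : List ℕ → Finset ℕ
  | [] => ∅
  | w :: ws => insert (w + ws.length) ws.betaSet

theorem List.mem_betaSet {l : List ℕ} {x : ℕ} :
    x ∈ l.betaSet ↔ ∃ i, ∃ h : i < l.length, x = l[i] + (l.length - 1 - i) := by
  induction l with
  | nil => simp [List.betaSet]
  | cons w ws ih =>
    rw [List.betaSet, Finset.mem_insert, ih]
    constructor
    · rintro (rfl | ⟨i, h, rfl⟩)
      · exact ⟨0, by simp, by simp⟩
      · exact ⟨i + 1, by simpa using h, by simp; omega⟩
    · rintro ⟨i, h, rfl⟩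
      rcases i with _ | i
      · left; simp
      · right
        simp only [List.length_cons] at h
        exact ⟨i, by omega, by simp; omega⟩

theorem List.lt_of_mem_betaSet {w : ℕ} {ws : List ℕ} (h : (w :: ws).Pairwise (· ≥ ·)) {x : ℕ}
    (hx : x ∈ ws.betaSet) : x < w + ws.length := by
  obtain ⟨i, hi, rfl⟩ := List.mem_betaSet.1 hx
  have := (List.pairwise_cons.1 h).1 _ (List.getElem_mem hi)
  omega

theorem List.card_betaSet {l : List ℕ} (h : l.Pairwise (· ≥ ·)) : l.betaSet.card = l.length := by
  induction l with
  | nil => rfl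
  | cons w ws ih =>
    rw [List.betaSet, Finset.card_insert_of_notMem fun hx => (List.lt_of_mem_betaSet h hx).false,
      ih (List.pairwise_cons.1 h).2, List.length_cons]

theorem List.sum_betaSet {l : List ℕ} (h : l.Pairwise (· ≥ ·)) :
    ∑ x ∈ l.betaSet, x = l.sum + ∑ i ∈ Finset.range l.length, i := by
  induction l with
  | nil => rfl
  | cons w ws ih =>
    rw [List.betaSet, Finset.sum_insert fun hx => (List.lt_of_mem_betaSet h hx).false,
      ih (List.pairwise_cons.1 h).2, List.length_cons, Finset.sum_range_succ, List.sum_cons]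
    ring

theorem List.betaSet_inj {l l' : List ℕ} (h : l.Pairwise (· ≥ ·)) (h' : l'.Pairwise (· ≥ ·))
    (he : l.betaSet = l'.betaSet) : l = l' := by
  induction l generalizing l' with
  | nil =>
    have := List.card_betaSet h'
    rw [← he] at this
    exact (List.length_eq_zero_iff.1 this.symm).symm
  | cons w ws ih =>
    have hc := List.card_betaSet h
    rw [he, List.card_betaSet h'] at hc
    rcases l' with _ | ⟨v, vs⟩
    · simp at hc
    simp only [List.length_cons, Nat.add_right_cancel_iff] at hc
    simp only [List.betaSet] at he
    have h1 : w + ws.length ∈ insert (v + vs.length) vs.betaSet := he ▸ Finset.mem_insert_self _ _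
    have h2 : v + vs.length ∈ insert (w + ws.length) ws.betaSet := he ▸ Finset.mem_insert_self _ _
    have hwv : w = v := by
      rcases Finset.mem_insert.1 h1 with h1 | h1
      · omega
      rcases Finset.mem_insert.1 h2 with h2 | h2
      · omega
      have h1 := List.lt_of_mem_betaSet h' h1
      have h2 := List.lt_of_mem_betaSet h h2
      omega
    subst hwv
    rw [hc] at he
    have he' := congrArg (fun s => s.erase (w + ws.length)) he
    rw [Finset.erase_insert fun hx => (List.lt_of_mem_betaSet h' hx).ne (by rw [hc]),
      Finset.erase_insert fun hx => (List.lt_of_mem_betaSet h hx).false] at he'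
    rw [ih (List.pairwise_cons.1 h).2 (List.pairwise_cons.1 h').2 he']

/-- Induction on the maximum `a`, which becomes the hook length of a new first part `a - l.length`.
The condition `0 ∉ X` keeps parts positive. -/
theorem List.exists_betaSet_eq (X : Finset ℕ) (h0 : 0 ∉ X) :
    ∃ l : List ℕ, l.Pairwise (· ≥ ·) ∧ (∀ x ∈ l, 0 < x) ∧ l.betaSet = X := by
  induction X using Finset.induction_on_max with
  | empty => exact ⟨[], by simp, by simp, rfl⟩
  | insert a X ha ih =>
    obtain ⟨l, hl, hpos, rfl⟩ := ih fun h => h0 (Finset.mem_insert_of_mem h)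
    have ha0 : a ≠ 0 := by rintro rfl; exact h0 (Finset.mem_insert_self _ _)
    have hb : ∀ x ∈ l, x + l.length ≤ a := by
      intro x hx
      obtain ⟨i, hi, rfl⟩ := List.getElem_of_mem hx
      have h1 : l[i] ≤ l[0] := by
        rcases i with _ | i
        · exact le_rfl
        · exact List.pairwise_iff_getElem.1 hl 0 (i + 1) (by omega) hi (by omega)
      have := ha _ (List.mem_betaSet.2 ⟨0, by omega, rfl⟩)
      omega
    have hlt : l.length < a := by
      rcases l with _ | ⟨v, vs⟩
      · simpa using Nat.pos_of_ne_zero ha0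
      · have := hb v (by simp)
        have := hpos v (by simp)
        omega
    refine ⟨(a - l.length) :: l, List.pairwise_cons.2 ⟨fun x hx => ?_, hl⟩, ?_, ?_⟩
    · have := hb x hx
      omega
    · intro x hx
      rcases List.mem_cons.1 hx with rfl | hx
      · omega
      · exact hpos x hx
    · rw [List.betaSet, Nat.sub_add_cancel hlt.le]

theorem YoungDiagram.mem_betaSet_rowLens {μ : YoungDiagram} {x : ℕ} :
    x ∈ μ.rowLens.betaSet ↔ ∃ i < μ.colLen 0, x = μ.rowLen i + (μ.colLen 0 - 1 - i) := by
  simp [List.mem_betaSet]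

/-- The numbers below a first column hook length that are not first column hook lengths. -/
theorem YoungDiagram.range_sdiff_betaSet (μ : YoungDiagram) {i : ℕ} (hi : i < μ.colLen 0) :
    Finset.range (μ.rowLen i + (μ.colLen 0 - 1 - i)) \ μ.rowLens.betaSet =
      (Finset.range (μ.rowLen i)).image fun j => j + (μ.colLen 0 - μ.colLen j) := by
  symm
  have hle (j : ℕ) : μ.colLen j ≤ μ.colLen 0 := μ.colLen_anti 0 j (Nat.zero_le j)
  have hiff (i j : ℕ) : j < μ.rowLen i ↔ i < μ.colLen j := by
    rw [← mem_iff_lt_rowLen, mem_iff_lt_colLen]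
  -- The proposed gaps are distinct and avoid the beta-set; the beta-numbers of the rows below `i`
  -- leave room for no more.
  apply Finset.eq_of_subset_of_card_le
  · intro y hy
    simp only [Finset.mem_image, Finset.mem_range, Finset.mem_sdiff, mem_betaSet_rowLens] at hy ⊢
    obtain ⟨j, hj, rfl⟩ := hy
    refine ⟨?_, ?_⟩
    · have := (hiff i j).1 hj
      omega
    -- The beta-number of row `k` exceeds the gap of column `j` if `(k, j)` is a cell and is smaller
    -- otherwise.
    · rintro ⟨k, hk, h⟩
      have := hiff k j
      have := hle j
      omega
  · have hmono : StrictMono fun j => j + (μ.colLen 0 - μ.colLen j) := by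
      intro j k hjk
      have := μ.colLen_anti j k hjk.le
      dsimp only
      omega
    rw [Finset.card_image_of_injective _ hmono.injective, Finset.card_range,
      Finset.card_sdiff, Finset.card_range]
    have hsub : (Finset.Ioo i (μ.colLen 0)).image (fun k => μ.rowLen k + (μ.colLen 0 - 1 - k)) ⊆
        μ.rowLens.betaSet ∩ Finset.range (μ.rowLen i + (μ.colLen 0 - 1 - i)) := by
      intro x hx
      simp only [Finset.mem_image, Finset.mem_Ioo] at hx
      obtain ⟨k, hk, rfl⟩ := hx
      have := μ.rowLen_anti i k hk.1.le
      simp only [Finset.mem_inter, mem_betaSet_rowLens, Finset.mem_range]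
      exact ⟨⟨k, hk.2, rfl⟩, by omega⟩
    have hcard := Finset.card_le_card hsub
    rw [Finset.card_image_of_injOn, Nat.card_Ioo] at hcard
    · omega
    · intro k hk k' hk' h
      simp only [Finset.coe_Ioo, Set.mem_Ioo] at hk hk'
      dsimp only at h
      rcases lt_trichotomy k k' with hlt | hlt | hlt
      · have := μ.rowLen_anti k k' hlt.le
        omega
      · exact hlt
      · have := μ.rowLen_anti k' k hlt.le
        omega

theorem YoungDiagram.hookNumber_add (μ : YoungDiagram) {i j : ℕ} (h : (i, j) ∈ μ) :
    μ.hookNumber (i, j) + (j + (μ.colLen 0 - μ.colLen j)) =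
      μ.rowLen i + (μ.colLen 0 - 1 - i) := by
  have h1 := mem_iff_lt_rowLen.1 h
  have h2 := mem_iff_lt_colLen.1 h
  have h3 := μ.colLen_anti 0 j (Nat.zero_le j)
  simp only [hookNumber]
  omega

/-- The hook numbers in a row are the differences `x - y`, with `x` the beta-number of the row and
`y` running over the gaps below `x`. -/
theorem YoungDiagram.forall_not_dvd_hookNumber_iff (μ : YoungDiagram) (t : ℕ) :
    (∀ c ∈ μ.cells, ¬ t ∣ μ.hookNumber c) ↔
      ∀ x ∈ μ.rowLens.betaSet, ∀ y < x, t ∣ x - y → y ∈ μ.rowLens.betaSet := by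
  constructor
  · intro h x hx y hy hd
    obtain ⟨i, hi, rfl⟩ := mem_betaSet_rowLens.1 hx
    by_contra hmem
    have : y ∈ Finset.range (μ.rowLen i + (μ.colLen 0 - 1 - i)) \ μ.rowLens.betaSet := by
      simp [hy, hmem]
    rw [μ.range_sdiff_betaSet hi] at this
    simp only [Finset.mem_image, Finset.mem_range] at this
    obtain ⟨j, hj, rfl⟩ := this
    have hc := mem_iff_lt_rowLen.2 hj
    rw [← μ.hookNumber_add hc, Nat.add_sub_cancel] at hd
    exact h _ hc hd
  · rintro h ⟨i, j⟩ hc hd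
    rw [mem_cells] at hc
    have hi : i < μ.colLen 0 :=
      (mem_iff_lt_colLen.1 hc).trans_le (μ.colLen_anti 0 j (Nat.zero_le j))
    have hj := mem_iff_lt_rowLen.1 hc
    have hy := Finset.mem_image_of_mem (fun j => j + (μ.colLen 0 - μ.colLen j))
      (Finset.mem_range.2 hj)
    rw [← μ.range_sdiff_betaSet hi, Finset.mem_sdiff, Finset.mem_range] at hy
    refine hy.2 (h _ (mem_betaSet_rowLens.2 ⟨i, hi, rfl⟩) _ hy.1 ?_)
    rwa [← μ.hookNumber_add hc, Nat.add_sub_cancel]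

/-- The set of first column hook lengths of a partition. -/
def Nat.Partition.betaSet {n : ℕ} (lam : n.Partition) : Finset ℕ :=
  (lam.parts.sort (· ≥ ·)).betaSet

theorem Nat.Partition.isCore_iff {n : ℕ} (lam : n.Partition) (t : ℕ) :
    lam.IsCore t ↔ ∀ x ∈ lam.betaSet, ∀ y < x, t ∣ x - y → y ∈ lam.betaSet := by
  have h : lam.youngDiagram.rowLens = lam.parts.sort (· ≥ ·) :=
    YoungDiagram.rowLens_ofRowLens_eq_self fun x hx => lam.parts_pos (by simpa using hx)
  rw [IsCore, YoungDiagram.forall_not_dvd_hookNumber_iff, h, betaSet]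

theorem Nat.Partition.zero_notMem_betaSet {n : ℕ} (lam : n.Partition) : 0 ∉ lam.betaSet := by
  intro h
  obtain ⟨i, hi, h⟩ := List.mem_betaSet.1 h
  have := lam.parts_pos ((Multiset.mem_sort (· ≥ ·)).1 (List.getElem_mem hi))
  omega

theorem Nat.Partition.sum_betaSet {n : ℕ} (lam : n.Partition) :
    ∑ x ∈ lam.betaSet, x = n + ∑ i ∈ Finset.range lam.betaSet.card, i := by
  have h := Multiset.pairwise_sort lam.parts (· ≥ ·)
  rw [betaSet, List.sum_betaSet h, List.card_betaSet h, ← Multiset.sum_coe, Multiset.sort_eq,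
    lam.parts_sum]

theorem Nat.Partition.betaSet_injective {n : ℕ} :
    Function.Injective (betaSet : n.Partition → Finset ℕ) := by
  intro lam lam' h
  have := List.betaSet_inj (Multiset.pairwise_sort _ _) (Multiset.pairwise_sort _ _) h
  apply Nat.Partition.ext
  rw [← Multiset.sort_eq lam.parts (· ≥ ·), this, Multiset.sort_eq]

theorem Nat.Partition.exists_betaSet_eq {n : ℕ} (X : Finset ℕ) (h0 : 0 ∉ X)
    (hsum : ∑ x ∈ X, x = n + ∑ i ∈ Finset.range X.card, i) :
    ∃ lam : n.Partition, lam.betaSet = X := by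
  obtain ⟨l, hl, hpos, rfl⟩ := List.exists_betaSet_eq X h0
  rw [List.sum_betaSet hl, List.card_betaSet hl, Nat.add_right_cancel_iff] at hsum
  refine ⟨⟨l, fun {i} hi => hpos i (by simpa using hi), by simpa using hsum⟩, ?_⟩
  rw [betaSet]
  congr 1
  refine List.Perm.eq_of_pairwise' (r := (· ≥ ·)) (Multiset.pairwise_sort _ _) hl ?_
  rw [← Multiset.coe_eq_coe, Multiset.sort_eq]

/-! ### Classification and count of 3-cores -/

/-- The `A` smallest positive integers `≡ 1` and the `B` smallest `≡ 2` modulo `3`. -/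
def residueSet (A B : ℕ) : Finset ℕ :=
  (Finset.range A).image (3 * · + 1) ∪ (Finset.range B).image (3 * · + 2)

theorem mem_residueSet {A B x : ℕ} :
    x ∈ residueSet A B ↔ (∃ i < A, 3 * i + 1 = x) ∨ ∃ i < B, 3 * i + 2 = x := by
  simp [residueSet]

theorem residueSet_disjoint (A B : ℕ) :
    Disjoint ((Finset.range A).image (3 * · + 1)) ((Finset.range B).image (3 * · + 2)) := by
  refine Finset.disjoint_left.2 fun x h h' => ?_
  simp only [Finset.mem_image] at h h'
  obtain ⟨i, -, rfl⟩ := h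
  obtain ⟨j, -, h⟩ := h'
  omega

theorem card_residueSet (A B : ℕ) : (residueSet A B).card = A + B := by
  rw [residueSet, Finset.card_union_of_disjoint (residueSet_disjoint A B),
    Finset.card_image_of_injective _ fun a b h => by simpa using h,
    Finset.card_image_of_injective _ fun a b h => by simpa using h, Finset.card_range,
    Finset.card_range]

theorem sum_residueSet (A B : ℕ) :
    2 * ∑ x ∈ residueSet A B, x + (A + B) = 3 * A ^ 2 + 3 * B ^ 2 + 2 * B := by
  rw [residueSet, Finset.sum_union (residueSet_disjoint A B),
    Finset.sum_image fun a _ b _ h => by simpa using h,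
    Finset.sum_image fun a _ b _ h => by simpa using h]
  have h1 : 2 * ∑ i ∈ Finset.range A, (3 * i + 1) + A = 3 * A ^ 2 := by
    induction A with
    | zero => rfl
    | succ k ih => rw [Finset.sum_range_succ]; linarith
  have h2 : 2 * ∑ i ∈ Finset.range B, (3 * i + 2) = 3 * B ^ 2 + B := by
    induction B with
    | zero => rfl
    | succ k ih => rw [Finset.sum_range_succ]; linarith
  linarith

/-- The size is the sum of the beta-set minus a triangular number; doubled, this reads `3A² + 3B² +
2B - (A + B)² = 2n`. -/
theorem sum_residueSet_eq_iff (A B n : ℕ) :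
    ∑ x ∈ residueSet A B, x = n + ∑ i ∈ Finset.range (residueSet A B).card, i ↔
      (A, B) ∈ coreParams n := by
  have h1 := sum_residueSet A B
  have h2 (k : ℕ) : 2 * ∑ i ∈ Finset.range k, i + k = k ^ 2 := by
    induction k with
    | zero => rfl
    | succ k ih => rw [Finset.sum_range_succ]; linarith
  have h2 := h2 (A + B)
  rw [card_residueSet]
  simp only [coreParams, Set.mem_ofPred_eq]
  constructor
  · intro h; rw [h] at h1; nlinarith
  · intro h; nlinarith

theorem residueSet_injective : Function.Injective fun v : ℕ × ℕ => residueSet v.1 v.2 := by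
  have key {A B A' B' : ℕ} (h : residueSet A B ⊆ residueSet A' B') : A ≤ A' ∧ B ≤ B' := by
    constructor
    · by_contra hlt
      have := mem_residueSet.1 (h (mem_residueSet.2 (Or.inl ⟨A', by omega, rfl⟩)))
      omega
    · by_contra hlt
      have := mem_residueSet.1 (h (mem_residueSet.2 (Or.inr ⟨B', by omega, rfl⟩)))
      omega
  intro v w h
  have h1 := key (subset_of_eq h)
  have h2 := key (subset_of_eq h.symm)
  exact Prod.ext (le_antisymm h1.1 h2.1) (le_antisymm h1.2 h2.2)

theorem exists_forall_mem_iff_lt (X : Finset ℕ) (h : ∀ x ∈ X, ∀ y < x, 3 ∣ x - y → y ∈ X) (r : ℕ) :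
    ∃ A, ∀ i, 3 * i + r ∈ X ↔ i < A := by
  classical
  have hex : ∃ i, 3 * i + r ∉ X := by
    obtain ⟨N, hN⟩ := X.bddAbove
    refine ⟨N + 1, fun hmem => ?_⟩
    have := hN hmem
    omega
  refine ⟨Nat.find hex, fun i => ⟨fun hi => ?_, fun hi => not_not.1 (Nat.find_min hex hi)⟩⟩
  by_contra hle
  rcases (not_lt.1 hle).eq_or_lt with he | hlt
  · exact Nat.find_spec hex (by rwa [he])
  · exact Nat.find_spec hex (h _ hi _ (by omega) (by omega))

theorem exists_eq_residueSet (X : Finset ℕ) (h0 : 0 ∉ X)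
    (h : ∀ x ∈ X, ∀ y < x, 3 ∣ x - y → y ∈ X) : ∃ A B, X = residueSet A B := by
  obtain ⟨A, hA⟩ := exists_forall_mem_iff_lt X h 1
  obtain ⟨B, hB⟩ := exists_forall_mem_iff_lt X h 2
  refine ⟨A, B, ?_⟩
  ext x
  rw [mem_residueSet]
  constructor
  · intro hx
    obtain h3 | h3 | h3 : x % 3 = 0 ∨ x % 3 = 1 ∨ x % 3 = 2 := by omega
    -- A multiple of 3 in the set would bring 0 into it by descent.
    · rcases Nat.eq_zero_or_pos x with rfl | hpos
      · exact absurd hx h0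
      · exact absurd (h x hx 0 hpos (by omega)) h0
    · have e : 3 * (x / 3) + 1 = x := by omega
      exact Or.inl ⟨x / 3, (hA _).1 (by rwa [e]), e⟩
    · have e : 3 * (x / 3) + 2 = x := by omega
      exact Or.inr ⟨x / 3, (hB _).1 (by rwa [e]), e⟩
  · rintro (⟨i, hi, rfl⟩ | ⟨i, hi, rfl⟩)
    · exact (hA i).2 hi
    · exact (hB i).2 hi

theorem residueSet_closed (A B : ℕ) :
    ∀ x ∈ residueSet A B, ∀ y < x, 3 ∣ x - y → y ∈ residueSet A B := by
  intro x hx y hy hd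
  rw [mem_residueSet] at hx ⊢
  rcases hx with ⟨i, hi, rfl⟩ | ⟨i, hi, rfl⟩
  · exact Or.inl ⟨y / 3, by omega, by omega⟩
  · exact Or.inr ⟨y / 3, by omega, by omega⟩

/-- The number of `3`-cores of `n`. -/
theorem card_isCore_three (n : ℕ) :
    Nat.card {lam : n.Partition // lam.IsCore 3} = (coreParams n).ncard := by
  have hex (v : coreParams n) : ∃ lam : {lam : n.Partition // lam.IsCore 3},
      lam.1.betaSet = residueSet v.1.1 v.1.2 := by
    obtain ⟨lam, hlam⟩ := Nat.Partition.exists_betaSet_eq (n := n) (residueSet v.1.1 v.1.2)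
      (by simp [mem_residueSet]) ((sum_residueSet_eq_iff _ _ n).2 v.2)
    refine ⟨⟨lam, (lam.isCore_iff 3).2 ?_⟩, hlam⟩
    rw [hlam]
    exact residueSet_closed _ _
  choose f hf using hex
  symm
  refine Nat.card_congr (Equiv.ofBijective f ⟨fun v w h => ?_, fun lam => ?_⟩)
  · apply Subtype.ext
    apply residueSet_injective
    dsimp only
    rw [← hf, ← hf, h]
  · obtain ⟨A, B, hAB⟩ := exists_eq_residueSet lam.1.betaSet lam.1.zero_notMem_betaSet
      ((lam.1.isCore_iff 3).1 lam.2)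
    have hsum := lam.1.sum_betaSet
    rw [hAB, sum_residueSet_eq_iff] at hsum
    refine ⟨⟨(A, B), hsum⟩, Subtype.ext (Nat.Partition.betaSet_injective ?_)⟩
    rw [hf, hAB]

/-! ### Pairs of cores and the divisor sum -/

theorem corePairCount_eq_sum (t n : ℕ) :
    corePairCount t n = ∑ s ∈ Finset.HasAntidiagonal.antidiagonal n,
      Nat.card {lam : s.1.Partition // lam.IsCore t} *
        Nat.card {lam : s.2.Partition // lam.IsCore t} := by
  rw [← Finset.sum_coe_sort, corePairCount]
  simp only [← Nat.card_prod]
  rw [← Nat.card_sigma]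
  refine Nat.card_congr
    { toFun := fun P => ⟨P.1.1, ⟨P.1.2.1, P.2.1⟩, ⟨P.1.2.2, P.2.2⟩⟩
      invFun := fun Q => ⟨⟨Q.1, Q.2.1.1, Q.2.2.1⟩, Q.2.1.2, Q.2.2.2⟩
      left_inv := fun _ => rfl
      right_inv := fun _ => rfl }

/-- The number of pairs of `3`-cores as a divisor sum. -/
theorem three_mul_corePairCount (n : ℕ) :
    3 * corePairCount 3 n = ArithmeticFunction.sigma 1 (3 * n + 2) := by
  rw [← @Nat.cast_inj ℤ, corePairCount_eq_sum, ArithmeticFunction.sigma_one_apply]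
  push_cast
  rw [← three_mul_sum_chiSum_three_mul_add_one]
  simp only [card_isCore_three, ncard_coreParams]

theorem corePairCount_prime_pow {p : ℕ} (hp : p.Prime) {k n N : ℕ} (hpn : ¬ p ∣ 3 * n + 2)
    (hN : 3 * N + 2 = p ^ k * (3 * n + 2)) :
    (corePairCount 3 N : ℚ) = ((p : ℚ) ^ (k + 1) - 1) / ((p : ℚ) - 1) * corePairCount 3 n := by
  have hcop : (p ^ k).Coprime (3 * n + 2) := ((hp.coprime_iff_not_dvd).2 hpn).pow_left k
  have h : 3 * corePairCount 3 N =
      (∑ i ∈ Finset.range (k + 1), p ^ i) * (3 * corePairCount 3 n) := by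
    rw [three_mul_corePairCount, three_mul_corePairCount, hN,
      ArithmeticFunction.isMultiplicative_sigma.map_mul_of_coprime hcop,
      ArithmeticFunction.sigma_one_apply_prime_pow hp]
  have h' : (3 : ℚ) * corePairCount 3 N =
      (∑ i ∈ Finset.range (k + 1), (p : ℚ) ^ i) * (3 * corePairCount 3 n) := by exact_mod_cast h
  rw [geom_sum_eq (by exact_mod_cast hp.one_lt.ne')] at h'
  linarith

/-- The shift is chosen so that `n ↦ 3n + 2` turns it into multiplication by `q`, which will be
`p^k` or `p^(2k)`. -/
theorem three_dvd_and_mul_eq {q n : ℕ} (hq : q % 3 = 1) :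
    3 ∣ 2 * q - 2 ∧ 3 * (q * n + (2 * q - 2) / 3) + 2 = q * (3 * n + 2) := by
  obtain ⟨a, rfl⟩ : ∃ a, q = 3 * a + 1 := ⟨q / 3, by omega⟩
  have h : 2 * (3 * a + 1) - 2 = 3 * (2 * a) := by omega
  rw [h, Nat.mul_div_cancel_left _ (by norm_num)]
  exact ⟨dvd_mul_right _ _, by ring⟩

theorem mainTheorem5 (p k n : ℕ) (hp : p.Prime) (hpn : ¬ p ∣ 3 * n + 2) :
    (p ≡ 1 [MOD 3] →
      3 ∣ 2 * p ^ k - 2 ∧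
      (corePairCount 3 (p ^ k * n + (2 * p ^ k - 2) / 3) : ℚ) =
        ((p : ℚ) ^ (k + 1) - 1) / ((p : ℚ) - 1) * corePairCount 3 n) ∧
    (p ≡ 2 [MOD 3] →
      3 ∣ 2 * p ^ (2 * k) - 2 ∧
      (corePairCount 3 (p ^ (2 * k) * n + (2 * p ^ (2 * k) - 2) / 3) : ℚ) =
        ((p : ℚ) ^ (2 * k + 1) - 1) / ((p : ℚ) - 1) * corePairCount 3 n) := by
  constructor
  · intro h
    have hq : p ^ k % 3 = 1 := by
      rw [h.pow k, one_pow, Nat.one_mod_eq_one.2 (by norm_num)]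
    obtain ⟨h1, h2⟩ := three_dvd_and_mul_eq (n := n) hq
    exact ⟨h1, corePairCount_prime_pow hp hpn h2⟩
  · intro h
    -- Only even exponents are used here, since `p ≡ 2` but `p² ≡ 1 (mod 3)`.
    have hq : p ^ (2 * k) % 3 = 1 := by
      have := (h.pow 2).pow k
      rw [← pow_mul] at this
      rw [this, Nat.pow_mod]; norm_num
    obtain ⟨h1, h2⟩ := three_dvd_and_mul_eq (n := n) hq
    exact ⟨h1, corePairCount_prime_pow hp hpn h2⟩
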